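/- Let $\mathbb R_+=(0,\infty)$, let $(\cdot,\cdot)$ and $\|\cdot\|$ be the inner product and norm of $L^2(\mathbb R_+)$ (real-valued functions), and $\|v\|_1=(\|v\|^2+\|v'\|^2)^{1/2}$ the norm of $H^1(\mathbb R_+)$. Let $H_0^1(\mathbb R_+)$ be the closure of $C_c^\infty(\mathbb R_+)$ in $H^1(\mathbb R_+)$. For $\beta>0$ and an integer $N\ge 0$ let $P_N$ be the real polynomials of degree at most $N$, $$\widehat P_N^{\beta}=\{e^{-\beta x/2}\psi(x):\psi\in P_N\},\qquad \widehat P_{N,\beta}^0=\{\phi\in\widehat P_N^\beta:\phi(0)=0\},$$ and let $\widehat\Pi_N^\beta:L^2(\mathbb R_+)\to\widehat P_N^\beta$ be the $L^2(\mathbb R_+)$-orthogonal projection. For $f$ continuous on $[0,\infty)$ let $\widehat I_N^\beta f\in\widehat P_N^\beta$ be the function that agrees with $f$ at the $N+1$ Laguerre--Gauss nodes, i.e. the zeros of $\mathscr L_{N+1}^{(0)}(\beta x)$, or, as a second choice, at the $N+1$ Laguerre--Gauss--Radau nodes, i.e. the zeros of $x\,\mathscr L_N^{(1)}(\beta x)$,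 where $\mathscr L_n^{(\alpha)}$ is the generalized Laguerre polynomial of degree $n$. For $\gamma>0$ put $a(u,v)=(u',v')+\gamma(u,v)$. Then for every $\gamma>0$ there is a constant $C>0$, depending only on $\gamma$, such that the following holds for either choice of nodes, all $\beta>0$, all integers $N\ge1$ and all $f\in C[0,\infty)\cap L^2(\mathbb R_+)$. If $u\in H_0^1(\mathbb R_+)$ is the weak solution of $-u''+\gamma u=f$ on $\mathbb R_+$, $u(0)=0$, $\lim_{x\to\infty}u(x)=0$, that is, $$a(u,v)=(f,v)\quad\text{for all }v\in H_0^1(\mathbb R_+),$$ and $u_{N,\beta}\in\widehat P_{N,\beta}^0$ is the solution of the Laguerre--Galerkin problem $$a(u_{N,\beta},v)=(\widehat I_N^\beta f,v)\quad\text{for all }v\in\widehat P_{N,\beta}^0,$$ then $$\|u-u_{N,\beta}\|_1\le C\Big[\Big(\frac1\beta+1\Big)\|u'-\widehat\Pi_{N-1}^\beta u'\|+(1+\beta)\|u-\widehat\Pi_{N-1}^\beta u\|+\|f-\widehat I_N^\beta f\|\Big].$$ -/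

import Mathlib

open MeasureTheory Set Polynomial

namespace LaguerreGalerkin

noncomputable section

/-- Lebesgue measure on the half line `ℝ₊ = (0, ∞)`. -/
abbrev muPos : Measure ℝ := volume.restrict (Ioi 0)

/-- The real Hilbert space `L²(ℝ₊)`. -/
abbrev L2 : Type := Lp ℝ 2 muPos

/-- The Hilbert sum `L²(ℝ₊) × L²(ℝ₊)`. A function `u ∈ H¹(ℝ₊)` is represented by the pair
`(u, u')` of `u` and its weak derivative, so that the norm of the pair is the `H¹` norm
`‖u‖₁ = (‖u‖² + ‖u'‖²)^(1/2)`. -/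
abbrev L2Pair : Type := WithLp 2 (L2 × L2)

/-- `φ ∈ C_c^∞(ℝ₊)`: smooth, with compact support contained in the open half line. -/
def IsTest (φ : ℝ → ℝ) : Prop :=
  ContDiff ℝ (⊤ : ℕ∞) φ ∧ HasCompactSupport φ ∧ tsupport φ ⊆ Ioi 0

/-- `g` is the weak derivative of `u` on `ℝ₊`. -/
def IsWeakDeriv (u g : L2) : Prop :=
  ∀ φ : ℝ → ℝ, IsTest φ →
    ∫ x in Ioi (0 : ℝ), u x * deriv φ x = -∫ x in Ioi (0 : ℝ), g x * φ x

/-- The Sobolev space `H¹(ℝ₊)`, as the set of pairs `(u, u')`. -/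
def H1 : Set L2Pair := {U | IsWeakDeriv U.fst U.snd}

/-- The pairs `(φ, φ')` with `φ ∈ C_c^∞(ℝ₊)`. -/
def testPairs : Set L2Pair :=
  {U | ∃ φ : ℝ → ℝ, IsTest φ ∧ U.fst =ᵐ[muPos] φ ∧ U.snd =ᵐ[muPos] deriv φ}

/-- `H¹₀(ℝ₊)`: the closure of `C_c^∞(ℝ₊)` in `H¹(ℝ₊)` for the `H¹` norm. -/
def H10 : Set L2Pair := H1 ∩ closure testPairs

/-- The bilinear form `a(u, v) = (u', v') + γ (u, v)`. -/
def bilin (γ : ℝ) (U V : L2Pair) : ℝ := inner ℝ U.snd V.snd + γ * inner ℝ U.fst V.fst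

/-- `(u, u')` is a weak solution of `-u'' + γ u = f` on `ℝ₊`, `u(0) = 0`, `u(∞) = 0`. -/
def IsWeakSolution (γ : ℝ) (f : ℝ → ℝ) (U : L2Pair) : Prop :=
  U ∈ H10 ∧ ∀ V ∈ H10, bilin γ U V = ∫ x in Ioi (0 : ℝ), f x * V.fst x

/-- The function `x ↦ e^{-βx/2} p(x)`. -/
def expPoly (β : ℝ) (p : ℝ[X]) (x : ℝ) : ℝ := Real.exp (-(β * x / 2)) * p.eval x

theorem memLp_expPoly {β : ℝ} (hβ : 0 < β) (p : ℝ[X]) : MemLp (expPoly β p) 2 muPos := by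
  have hc : Continuous (expPoly β p) := by
    unfold expPoly
    fun_prop
  rw [memLp_two_iff_integrable_sq hc.aestronglyMeasurable]
  have key : ∀ q : ℝ[X], (fun x : ℝ => q.eval x) =O[Filter.atTop]
      fun x : ℝ => Real.exp (β / 2 * x) := by
    intro q
    induction q using Polynomial.induction_on' with
    | add q r hq hr => simpa [Polynomial.eval_add] using hq.add hr
    | monomial n a =>
      simpa [Polynomial.eval_monomial] using
        ((isLittleO_pow_exp_pos_mul_atTop n (half_pos hβ)).isBigO).const_mul_left a
  refine integrable_of_isBigO_exp_neg (half_pos hβ) (hc.pow 2).continuousOn ?_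
  have h1 := (Asymptotics.isBigO_refl (fun x : ℝ => Real.exp (-(β * x))) Filter.atTop).mul
    (key (p ^ 2))
  refine (h1.congr_left ?_).congr_right ?_
  · intro x
    have : Real.exp (-(β * x)) = Real.exp (-(β * x / 2)) ^ 2 := by
      rw [← Real.exp_nat_mul]; congr 1; push_cast; ring
    simp only [expPoly, this, eval_pow]; ring
  · intro x
    rw [← Real.exp_add]; congr 1; ring

/-- `p ↦ e^{-βx/2} p(x)` as a linear map into `L²(ℝ₊)`. -/
def expPolyL2 {β : ℝ} (hβ : 0 < β) : ℝ[X] →ₗ[ℝ] L2 where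
  toFun p := (memLp_expPoly hβ p).toLp (expPoly β p)
  map_add' p q := by
    rw [← MemLp.toLp_add]
    congr 1
    funext x
    simp [expPoly, mul_add]
  map_smul' c p := by
    rw [RingHom.id_apply, ← MemLp.toLp_const_smul]
    congr 1
    funext x
    simp [expPoly, mul_left_comm]

/-- The space `{e^{-βx/2} ψ : ψ ∈ P_N}` of scaled Laguerre functions of degree at most `N`,
as a subspace of `L²(ℝ₊)`. -/
def lagSpace {β : ℝ} (hβ : 0 < β) (N : ℕ) : Submodule ℝ L2 :=
  (degreeLE ℝ N).map (expPolyL2 hβ)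

instance {β : ℝ} (hβ : 0 < β) (N : ℕ) : FiniteDimensional ℝ (lagSpace hβ N) := by
  classical
  rw [lagSpace, degreeLE_eq_span_X_pow, Submodule.map_span]
  exact FiniteDimensional.span_of_finite ℝ ((Finset.finite_toSet _).image _)

/-- The orthogonal projection of `L²(ℝ₊)` onto the space of scaled Laguerre functions of degree
at most `N`. -/
def lagProj {β : ℝ} (hβ : 0 < β) (N : ℕ) : L2 →L[ℝ] L2 := (lagSpace hβ N).starProjection

/-- The discrete space `{φ = e^{-βx/2} ψ : ψ ∈ P_N, φ(0) = 0}`, as the set of pairs `(φ, φ')`. -/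
def galerkinSpace (β : ℝ) (N : ℕ) : Set L2Pair :=
  {U | ∃ p ∈ degreeLE ℝ N, expPoly β p 0 = 0 ∧
    U.fst =ᵐ[muPos] expPoly β p ∧ U.snd =ᵐ[muPos] deriv (expPoly β p)}

/-- The generalized Laguerre polynomial
`L_n^{(α)}(x) = ∑_{k ≤ n} (-1)^k binom(n + α, n - k) x^k / k!`. -/
def laguerre (α : ℝ) (n : ℕ) : ℝ[X] :=
  ∑ k ∈ Finset.range (n + 1),
    C ((-1) ^ k * Ring.choose ((n : ℝ) + α) (n - k) / (k.factorial : ℝ)) * X ^ k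

/-- The two families of interpolation nodes: Laguerre–Gauss and Laguerre–Gauss–Radau. -/
inductive Rule
  | gauss
  | radau

/-- The polynomial whose zeros are the `N + 1` interpolation nodes:
`L_{N+1}^{(0)}(βx)` (Gauss) or `x L_N^{(1)}(βx)` (Gauss–Radau). -/
def nodePoly (Z : Rule) (β : ℝ) (N : ℕ) : ℝ[X] :=
  match Z with
  | .gauss => (laguerre 0 (N + 1)).comp (C β * X)
  | .radau => X * (laguerre 1 N).comp (C β * X)

/-- The set of interpolation nodes. -/
def nodes (Z : Rule) (β : ℝ) (N : ℕ) : Finset ℝ := (nodePoly Z β N).roots.toFinset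

/-- The interpolant of `f` of the form `e^{-βx/2} ψ(x)`, `ψ ∈ P_N`, that agrees with `f`
at the nodes. -/
def interp (Z : Rule) (β : ℝ) (N : ℕ) (f : ℝ → ℝ) : ℝ → ℝ :=
  expPoly β (Lagrange.interpolate (nodes Z β N) id fun ξ => Real.exp (β * ξ / 2) * f ξ)

/-- `(u_N, u_N')` solves the Laguerre–Galerkin problem with interpolated right-hand side. -/
def IsGalerkinSolution (Z : Rule) (γ β : ℝ) (N : ℕ) (f : ℝ → ℝ) (UN : L2Pair) : Prop :=
  UN ∈ galerkinSpace β N ∧ ∀ V ∈ galerkinSpace β N,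
    bilin γ UN V = ∫ x in Ioi (0 : ℝ), interp Z β N f x * V.fst x

/-- The `L²(ℝ₊)` norm of a square integrable function. -/
def normL2 (g : ℝ → ℝ) : ℝ := (eLpNorm g 2 muPos).toReal

end

end LaguerreGalerkin

open LaguerreGalerkin

/-!
Idea of the proof. The operator `T u = u' + (β/2) u = e^{-βx/2} (e^{βx/2} u)'` maps the discrete
space of degree `N + 1` onto all scaled Laguerre functions of degree at most `N`. On `H¹₀(ℝ₊)` a
function is `L²`-orthogonal to its derivative, so `‖T u‖² = ‖u'‖² + (β/2)² ‖u‖²` and `T` controls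
the `H¹` norm. The discrete function `w` with `T w = Π (T u)`, where `Π` is the orthogonal
projection, is therefore a good approximation of `u`, and Strang's lemma for the coercive form `a`
transfers its error to the Galerkin solution.
-/

open Filter Topology
open scoped ContDiff

namespace LaguerreGalerkin

section DominatedConvergence

variable {α ι E : Type*} [MeasurableSpace α] {μ : Measure α} [NormedAddCommGroup E]
  {l : Filter ι} [l.IsCountablyGenerated] {p : ENNReal}

theorem tendsto_toLp_of_dominated [Fact (1 ≤ p)] (hp : p ≠ ⊤) {F : ι → α → E} {f : α → E}
    {g : α → ℝ} (hF : ∀ i, MemLp (F i) p μ) (hf : MemLp f p μ) (hg : MemLp g p μ)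
    (hbound : ∀ᶠ i in l, ∀ᵐ x ∂μ, ‖F i x - f x‖ ≤ g x)
    (hlim : ∀ᵐ x ∂μ, Tendsto (fun i => F i x) l (𝓝 (f x))) :
    Tendsto (fun i => (hF i).toLp (F i)) l (𝓝 (hf.toLp f)) := by
  have hp0 : p ≠ 0 := (zero_lt_one.trans_le Fact.out).ne'
  have hpos : 0 < p.toReal := ENNReal.toReal_pos hp0 hp
  rw [Lp.tendsto_Lp_iff_tendsto_eLpNorm'']
  simp only [eLpNorm_eq_lintegral_rpow_enorm_toReal hp0 hp]
  suffices h : Tendsto (fun i => ∫⁻ x, ‖(F i - f) x‖ₑ ^ p.toReal ∂μ) l (𝓝 0) by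
    simpa [hpos] using h.ennrpow_const (1 / p.toReal)
  rw [← lintegral_zero (μ := μ)]
  refine tendsto_lintegral_filter_of_dominated_convergence' (fun x => ‖g x‖ₑ ^ p.toReal)
    (Eventually.of_forall fun i => ((hF i).sub hf).1.enorm.pow_const _) ?_
    (lintegral_rpow_enorm_lt_top_of_eLpNorm_lt_top hp0 hp hg.2).ne ?_
  · filter_upwards [hbound] with i hi
    filter_upwards [hi] with x hx
    gcongr
    exact enorm_le_iff_norm_le.2 (hx.trans (le_abs_self _))
  · filter_upwards [hlim] with x hx
    simpa [hpos] using ((hx.sub_const (f x)).enorm).ennrpow_const p.toReal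

end DominatedConvergence

theorem exists_mem_degreeLE_derivative_eq {K : Type*} [Field K] [CharZero K] {n : ℕ} {q : K[X]}
    (hq : q ∈ degreeLE K n) :
    ∃ p ∈ degreeLE K (n + 1 : ℕ), p.eval 0 = 0 ∧ derivative p = q := by
  have hdeg : q.natDegree < n + 1 :=
    Nat.lt_succ_of_le (natDegree_le_of_degree_le (mem_degreeLE.1 hq))
  refine ⟨∑ i ∈ Finset.range (n + 1), C (q.coeff i / (i + 1)) * X ^ (i + 1), ?_, ?_, ?_⟩
  · refine Submodule.sum_mem _ fun i hi => mem_degreeLE.2 ((degree_C_mul_X_pow_le _ _).trans ?_)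
    exact mod_cast Finset.mem_range.1 hi
  · simp [eval_finsetSum]
  · conv_rhs => rw [q.as_sum_range_C_mul_X_pow' hdeg]
    rw [derivative_sum]
    refine Finset.sum_congr rfl fun i _ => ?_
    rw [derivative_C_mul_X_pow, Nat.cast_succ, div_mul_cancel₀ _ i.cast_add_one_ne_zero,
      Nat.add_sub_cancel]

theorem norm_sub_le_of_coercive {E : Type*} [SeminormedAddCommGroup E] [NormedSpace ℝ E]
    {a : LinearMap.BilinForm ℝ E} {S : Submodule ℝ E} {c M ε : ℝ} {u v w : E} (hc : 0 < c)
    (hε : 0 ≤ ε) (hM : 0 ≤ M)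
    (hcoer : ∀ z ∈ S, c * ‖z‖ ^ 2 ≤ a z z) (hbound : ∀ z ∈ S, a (u - w) z ≤ M * ‖u - w‖ * ‖z‖)
    (hcons : ∀ z ∈ S, a (v - u) z ≤ ε * ‖z‖) (hv : v ∈ S) (hw : w ∈ S) :
    ‖u - v‖ ≤ (1 + M / c) * ‖u - w‖ + ε / c := by
  have hz : v - w ∈ S := S.sub_mem hv hw
  have hsplit : a (v - w) (v - w) = a (v - u) (v - w) + a (u - w) (v - w) := by
    rw [← LinearMap.add_apply, ← map_add, sub_add_sub_cancel]
  have henergy : c * ‖v - w‖ * ‖v - w‖ ≤ (ε + M * ‖u - w‖) * ‖v - w‖ := by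
    linarith [hcoer _ hz, hbound _ hz, hcons _ hz]
  have hdiscrete : ‖v - w‖ ≤ (ε + M * ‖u - w‖) / c := by
    rw [le_div_iff₀' hc]
    rcases (norm_nonneg (v - w)).eq_or_lt with h | h
    · rw [← h, mul_zero]
      positivity
    · exact le_of_mul_le_mul_right henergy h
  calc ‖u - v‖ = ‖(u - w) - (v - w)‖ := by rw [sub_sub_sub_cancel_right]
    _ ≤ ‖u - w‖ + (ε + M * ‖u - w‖) / c := (norm_sub_le _ _).trans (by gcongr)
    _ = (1 + M / c) * ‖u - w‖ + ε / c := by ring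

theorem inner_eq_setIntegral {u v : L2} {f g : ℝ → ℝ} (hu : u =ᵐ[muPos] f)
    (hv : v =ᵐ[muPos] g) : inner ℝ u v = ∫ x in Ioi (0 : ℝ), f x * g x := by
  rw [L2.inner_def]
  refine integral_congr_ae ?_
  filter_upwards [hu, hv] with x hux hvx
  simp [hux, hvx, mul_comm]

namespace IsTest

variable {φ ψ : ℝ → ℝ}

theorem differentiable (h : IsTest φ) : Differentiable ℝ φ := h.1.differentiable (by simp)

theorem continuous_deriv (h : IsTest φ) : Continuous (deriv φ) := h.1.continuous_deriv (by simp)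

theorem apply_zero (h : IsTest φ) : φ 0 = 0 :=
  image_eq_zero_of_notMem_tsupport fun h0 => lt_irrefl (0 : ℝ) (h.2.2 h0)

theorem zero : IsTest 0 := ⟨contDiff_const, HasCompactSupport.zero, by simp⟩

theorem add (h : IsTest φ) (h' : IsTest ψ) : IsTest (φ + ψ) :=
  ⟨h.1.add h'.1, h.2.1.add h'.2.1, (tsupport_add _ _).trans (union_subset h.2.2 h'.2.2)⟩

theorem const_smul (c : ℝ) (h : IsTest φ) : IsTest (c • φ) :=
  ⟨h.1.const_smul c, h.2.1.mono (Function.support_const_smul_subset c φ),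
    (closure_mono (Function.support_const_smul_subset c φ)).trans h.2.2⟩

theorem memLp (h : IsTest φ) : MemLp φ 2 muPos :=
  (h.1.continuous.memLp_of_hasCompactSupport h.2.1).restrict _

theorem memLp_deriv (h : IsTest φ) : MemLp (deriv φ) 2 muPos :=
  (h.continuous_deriv.memLp_of_hasCompactSupport h.2.1.deriv).restrict _

theorem integral_mul_deriv (h : IsTest φ) {w : ℝ → ℝ} (hw : ContDiff ℝ 1 w) :
    ∫ x in Ioi (0 : ℝ), w x * deriv φ x = -∫ x in Ioi (0 : ℝ), deriv w x * φ x := by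
  have hφ : ContDiff ℝ 1 φ := h.1.of_le (mod_cast le_top)
  have hderiv : deriv (fun x => w x * φ x) = fun x => deriv w x * φ x + w x * deriv φ x :=
    funext fun x => deriv_mul (hw.differentiable (by simp) x) (h.differentiable x)
  have hint : Integrable fun x => deriv w x * φ x :=
    ((hw.continuous_deriv le_rfl).mul h.1.continuous).integrable_of_hasCompactSupport
      h.2.1.mul_left
  have hint' : Integrable fun x => w x * deriv φ x :=
    (hw.continuous.mul h.continuous_deriv).integrable_of_hasCompactSupport h.2.1.deriv.mul_left
  have hsum : ∫ x in Ioi (0 : ℝ), deriv (fun x => w x * φ x) x = -(w 0 * φ 0) :=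
    HasCompactSupport.integral_Ioi_deriv_eq (hw.mul hφ) h.2.1.mul_left 0
  rw [hderiv, h.apply_zero, mul_zero, neg_zero,
    integral_add hint.integrableOn hint'.integrableOn] at hsum
  exact eq_neg_of_add_eq_zero_right hsum

end IsTest

/-- The pairs `(φ, φ')` with `φ ∈ C_c^∞(ℝ₊)` as a linear subspace, whose closure is
`H¹₀(ℝ₊)`. -/
def testSubmodule : Submodule ℝ L2Pair where
  carrier := testPairs
  zero_mem' := ⟨0, IsTest.zero, Lp.coeFn_zero _ _ _, by
    rw [deriv_zero]; exact Lp.coeFn_zero _ _ _⟩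
  add_mem' := by
    rintro U V ⟨φ, hφ, hU, hU'⟩ ⟨ψ, hψ, hV, hV'⟩
    have hderiv : deriv (φ + ψ) = deriv φ + deriv ψ :=
      funext fun x => deriv_add (hφ.differentiable x) (hψ.differentiable x)
    exact ⟨φ + ψ, hφ.add hψ, (Lp.coeFn_add _ _).trans (hU.add hV),
      hderiv ▸ (Lp.coeFn_add _ _).trans (hU'.add hV')⟩
  smul_mem' := by
    rintro c U ⟨φ, hφ, hU, hU'⟩
    have hderiv : deriv (c • φ) = c • deriv φ :=
      funext fun x => deriv_const_smul c (hφ.differentiable x)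
    exact ⟨c • φ, hφ.const_smul c, (Lp.coeFn_smul _ _).trans (hU.const_smul c),
      hderiv ▸ (Lp.coeFn_smul _ _).trans (hU'.const_smul c)⟩

theorem isWeakDeriv_iff_inner {u v : L2} :
    IsWeakDeriv u v ↔ ∀ (φ : ℝ → ℝ) (hφ : IsTest φ),
      inner ℝ u (hφ.memLp_deriv.toLp _) = -inner ℝ v (hφ.memLp.toLp _) := by
  refine forall₂_congr fun φ hφ => ?_
  rw [inner_eq_setIntegral ae_eq_rfl hφ.memLp_deriv.coeFn_toLp,
    inner_eq_setIntegral ae_eq_rfl hφ.memLp.coeFn_toLp]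

theorem isClosed_H1 : IsClosed H1 := by
  simp only [H1, isWeakDeriv_iff_inner, ofPred_forall]
  exact isClosed_iInter fun φ => isClosed_iInter fun hφ => isClosed_eq (by fun_prop) (by fun_prop)

theorem testPairs_subset_H1 : testPairs ⊆ H1 := by
  rintro U ⟨ψ, hψ, hU, hU'⟩
  refine isWeakDeriv_iff_inner.2 fun φ hφ => ?_
  rw [inner_eq_setIntegral hU hφ.memLp_deriv.coeFn_toLp,
    inner_eq_setIntegral hU' hφ.memLp.coeFn_toLp]
  exact hφ.integral_mul_deriv (hψ.1.of_le (mod_cast le_top))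

theorem coe_topologicalClosure_testSubmodule :
    (testSubmodule.topologicalClosure : Set L2Pair) = H10 :=
  (inter_eq_right.2 (isClosed_H1.closure_subset_iff.2 testPairs_subset_H1)).symm

theorem mem_topologicalClosure_testSubmodule {U : L2Pair} :
    U ∈ testSubmodule.topologicalClosure ↔ U ∈ H10 := by
  rw [← coe_topologicalClosure_testSubmodule, SetLike.mem_coe]

theorem sub_mem_H10 {U V : L2Pair} (hU : U ∈ H10) (hV : V ∈ H10) : U - V ∈ H10 := by
  rw [← mem_topologicalClosure_testSubmodule] at *
  exact Submodule.sub_mem _ hU hV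

theorem inner_fst_snd_eq_zero {U : L2Pair} (hU : U ∈ H10) : inner ℝ U.fst U.snd = 0 := by
  have hclosed : IsClosed {V : L2Pair | inner ℝ V.fst V.snd = (0 : ℝ)} :=
    isClosed_eq (by fun_prop) continuous_const
  refine closure_minimal ?_ hclosed hU.2
  rintro V ⟨φ, hφ, hV, hV'⟩
  have hneg : inner ℝ V.fst V.snd = -inner ℝ V.snd V.fst := by
    rw [inner_eq_setIntegral hV hV', inner_eq_setIntegral hV' hV]
    exact hφ.integral_mul_deriv (hφ.1.of_le (mod_cast le_top))
  rw [real_inner_comm V.fst V.snd] at hneg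
  exact self_eq_neg.1 hneg

/-- A cutoff on `(0, ∞)` that tends to `1` as `s → ∞`. The logarithmic scale keeps
`x (logCutoff χ s)'` bounded uniformly in `s`. -/
noncomputable def logCutoff (χ : ContDiffBump (0 : ℝ)) (s : ℝ) : ℝ → ℝ :=
  (Ioi 0).indicator fun x => χ (Real.log x / s)

section LogCutoff

variable {χ : ContDiffBump (0 : ℝ)} {s x : ℝ} {w : ℝ → ℝ}

theorem logCutoff_of_pos (hx : 0 < x) : logCutoff χ s x = χ (Real.log x / s) :=
  indicator_of_mem (mem_Ioi.2 hx) _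

theorem logCutoff_nonneg : 0 ≤ logCutoff χ s x :=
  indicator_nonneg (fun _ _ => χ.nonneg) x

theorem logCutoff_le_one : logCutoff χ s x ≤ 1 :=
  indicator_apply_le' (fun _ => χ.le_one) fun _ => zero_le_one

theorem contDiffAt_logCutoff (hx : 0 < x) : ContDiffAt ℝ ∞ (logCutoff χ s) x := by
  have hlog : ContDiffAt ℝ ∞ (fun y => χ (Real.log y / s)) x :=
    χ.contDiffAt.comp x ((Real.contDiffAt_log.2 hx.ne').div_const s)
  refine hlog.congr_of_eventuallyEq ?_
  filter_upwards [Ioi_mem_nhds hx] with y hy using logCutoff_of_pos hy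

theorem deriv_logCutoff (hx : 0 < x) :
    deriv (logCutoff χ s) x = deriv χ (Real.log x / s) / (s * x) := by
  have hχ : HasDerivAt χ (deriv χ (Real.log x / s)) (Real.log x / s) :=
    (χ.contDiff.differentiable (n := 1) (by simp) _).hasDerivAt
  have hlog := hχ.comp x ((Real.hasDerivAt_log hx.ne').div_const s)
  have heq : logCutoff χ s =ᶠ[𝓝 x] χ ∘ fun y => Real.log y / s := by
    filter_upwards [Ioi_mem_nhds hx] with y hy using logCutoff_of_pos hy
  rw [(hlog.congr_of_eventuallyEq heq).deriv]
  ring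

theorem tsupport_logCutoff_subset (hs : 0 < s) :
    tsupport (logCutoff χ s) ⊆ Icc (Real.exp (-(χ.rOut * s))) (Real.exp (χ.rOut * s)) := by
  refine closure_minimal (fun x hx => ?_) isClosed_Icc
  have hpos : 0 < x := by
    by_contra hx0
    exact hx (indicator_of_notMem hx0 _)
  rw [Function.mem_support, logCutoff_of_pos hpos, ← Function.mem_support, χ.support_eq,
    mem_ball_zero_iff, Real.norm_eq_abs, abs_lt, lt_div_iff₀ hs, div_lt_iff₀ hs, neg_mul] at hx
  exact ⟨(Real.le_log_iff_exp_le hpos).1 hx.1.le, (Real.log_le_iff_le_exp hpos).1 hx.2.le⟩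

theorem isTest_logCutoff_mul (hs : 0 < s) (hw : ContDiffOn ℝ ∞ w (Ioi 0)) :
    IsTest fun x => logCutoff χ s x * w x := by
  have hsub : tsupport (fun x => logCutoff χ s x * w x) ⊆
      Icc (Real.exp (-(χ.rOut * s))) (Real.exp (χ.rOut * s)) :=
    (tsupport_mul_subset_left (f := logCutoff χ s) (g := w)).trans (tsupport_logCutoff_subset hs)
  have hpos : tsupport (fun x => logCutoff χ s x * w x) ⊆ Ioi 0 :=
    fun x hx => (Real.exp_pos _).trans_le (hsub hx).1
  refine ⟨contMDiff_iff_contDiff.1 (contMDiff_of_tsupport fun x hx => ?_),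
    isCompact_Icc.of_isClosed_subset (isClosed_tsupport _) hsub, hpos⟩
  exact ((contDiffAt_logCutoff (hpos hx)).mul
    (hw.contDiffAt (Ioi_mem_nhds (hpos hx)))).contMDiffAt

theorem deriv_logCutoff_mul (hw : ContDiffOn ℝ ∞ w (Ioi 0)) (hx : 0 < x) :
    deriv (fun x => logCutoff χ s x * w x) x =
      deriv χ (Real.log x / s) / s * (w x / x) + logCutoff χ s x * deriv w x := by
  have hdw : DifferentiableAt ℝ w x :=
    (hw.contDiffAt (Ioi_mem_nhds hx)).differentiableAt (by simp)
  rw [deriv_fun_mul ((contDiffAt_logCutoff hx).differentiableAt (by simp)) hdw, deriv_logCutoff hx]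
  ring

theorem abs_logCutoff_mul_sub_le (y : ℝ) : |logCutoff χ s x * y - y| ≤ |y| := by
  have hfactor : logCutoff χ s x * y - y = (logCutoff χ s x - 1) * y := by ring
  rw [hfactor, abs_mul]
  refine mul_le_of_le_one_left (abs_nonneg y) (abs_le.2 ⟨?_, ?_⟩)
  · linarith [logCutoff_nonneg (χ := χ) (s := s) (x := x)]
  · linarith [logCutoff_le_one (χ := χ) (s := s) (x := x)]

theorem tendsto_logCutoff (hx : 0 < x) : Tendsto (fun s => logCutoff χ s x) atTop (𝓝 1) := by
  simp only [logCutoff_of_pos hx]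
  rw [← χ.one_of_mem_closedBall (Metric.mem_closedBall_self χ.rIn_pos.le)]
  exact (χ.continuous.tendsto 0).comp (tendsto_id.const_div_atTop _)

theorem tendsto_deriv_logCutoff_mul (hw : ContDiffOn ℝ ∞ w (Ioi 0)) (hx : 0 < x) :
    Tendsto (fun s => deriv (fun x => logCutoff χ s x * w x) x) atTop (𝓝 (deriv w x)) := by
  have hχ : Tendsto (fun s => deriv χ (Real.log x / s) / s) atTop (𝓝 0) :=
    (((χ.contDiff.continuous_deriv (n := 1) le_rfl).tendsto 0).comp
      (tendsto_id.const_div_atTop _)).div_atTop tendsto_id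
  simp only [deriv_logCutoff_mul hw hx]
  simpa using (hχ.mul_const (w x / x)).add ((tendsto_logCutoff hx).mul_const (deriv w x))

theorem exists_abs_deriv_logCutoff_mul_sub_le (hw : ContDiffOn ℝ ∞ w (Ioi 0)) :
    ∃ M : ℝ, ∀ s x, 1 ≤ s → 0 < x →
      |deriv (fun x => logCutoff χ s x * w x) x - deriv w x| ≤ M * |w x / x| + |deriv w x| := by
  obtain ⟨M, hM⟩ := (χ.contDiff.continuous_deriv (n := 1) le_rfl).bounded_above_of_compact_support
    χ.hasCompactSupport.deriv
  refine ⟨M, fun s x hs hx => ?_⟩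
  have hχ : |deriv χ (Real.log x / s) / s| ≤ M := by
    rw [abs_div, abs_of_pos (one_pos.trans_le hs)]
    exact (div_le_self (abs_nonneg _) hs).trans (hM _)
  rw [deriv_logCutoff_mul hw hx, add_sub_assoc]
  refine (abs_add_le _ _).trans (add_le_add ?_ (abs_logCutoff_mul_sub_le _))
  rw [abs_mul]
  gcongr

end LogCutoff

theorem mem_H10_of_contDiffOn {w : ℝ → ℝ} (hw : ContDiffOn ℝ ∞ w (Ioi 0))
    (hwL : MemLp w 2 muPos) (hwL' : MemLp (deriv w) 2 muPos)
    (hwx : MemLp (fun x => w x / x) 2 muPos) :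
    WithLp.toLp 2 (hwL.toLp w, hwL'.toLp (deriv w)) ∈ H10 := by
  set χ : ContDiffBump (0 : ℝ) := default
  set φ : ℕ → ℝ → ℝ := fun n x => logCutoff χ (n + 1) x * w x
  have hφ (n : ℕ) : IsTest (φ n) := isTest_logCutoff_mul (by positivity) hw
  have hscale : Tendsto (fun n : ℕ => (n : ℝ) + 1) atTop atTop :=
    tendsto_natCast_atTop_atTop.atTop_add tendsto_const_nhds
  have hfst : Tendsto (fun n => (hφ n).memLp.toLp (φ n)) atTop (𝓝 (hwL.toLp w)) := by
    refine tendsto_toLp_of_dominated (by simp) _ _ hwL.abs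
      (Eventually.of_forall fun n => ae_of_all _ fun x => abs_logCutoff_mul_sub_le _) ?_
    filter_upwards [ae_restrict_mem measurableSet_Ioi] with x hx
    simpa using (((tendsto_logCutoff hx).comp hscale).mul_const (w x))
  have hsnd : Tendsto (fun n => (hφ n).memLp_deriv.toLp (deriv (φ n))) atTop
      (𝓝 (hwL'.toLp (deriv w))) := by
    obtain ⟨M, hM⟩ := exists_abs_deriv_logCutoff_mul_sub_le (χ := χ) hw
    refine tendsto_toLp_of_dominated (by simp) _ _ ((hwx.abs.const_mul M).add hwL'.abs)
      (Eventually.of_forall fun n => ?_) ?_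
    · filter_upwards [ae_restrict_mem measurableSet_Ioi] with x hx
      exact hM _ x (le_add_of_nonneg_left n.cast_nonneg) hx
    · filter_upwards [ae_restrict_mem measurableSet_Ioi] with x hx
      exact (tendsto_deriv_logCutoff_mul hw hx).comp hscale
  rw [← mem_topologicalClosure_testSubmodule]
  exact mem_closure_of_tendsto
    (((WithLp.prod_continuous_toLp 2 L2 L2).tendsto _).comp (hfst.prodMk_nhds hsnd))
    (Eventually.of_forall fun n =>
      ⟨φ n, hφ n, (hφ n).memLp.coeFn_toLp, (hφ n).memLp_deriv.coeFn_toLp⟩)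

theorem contDiff_expPoly {n : WithTop ℕ∞} (β : ℝ) (p : ℝ[X]) : ContDiff ℝ n (expPoly β p) :=
  (Real.contDiff_exp.comp (by fun_prop)).mul (by simpa using p.contDiff_aeval (𝕜 := ℝ) n)

theorem deriv_expPoly (β : ℝ) (p : ℝ[X]) :
    deriv (expPoly β p) = expPoly β (derivative p - C (β / 2) * p) := by
  funext x
  have hlin : HasDerivAt (fun x : ℝ => -(β * x / 2)) (-(β * 1 / 2)) x :=
    (((hasDerivAt_id x).const_mul β).div_const 2).neg
  refine ((hlin.exp.mul (p.hasDerivAt x)).congr_deriv ?_).deriv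
  simp only [expPoly, eval_sub, eval_mul, eval_C]
  ring

section GalerkinSpace

variable {β : ℝ} (hβ : 0 < β)

/-- The linear map `p ↦ (φ, φ')` into the pairs representing `H¹(ℝ₊)`, where
`φ(x) = e^{-βx/2} p(x)`. -/
noncomputable def expPolyPair : ℝ[X] →ₗ[ℝ] L2Pair :=
  (WithLp.linearEquiv 2 ℝ (L2 × L2)).symm.toLinearMap ∘ₗ
    (expPolyL2 hβ).prod (expPolyL2 hβ ∘ₗ (derivative - LinearMap.mulLeft ℝ (C (β / 2))))

/-- The discrete space `galerkinSpace β N` as a linear subspace. -/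
noncomputable def galerkinSubmodule (N : ℕ) : Submodule ℝ L2Pair :=
  (degreeLE ℝ N ⊓ LinearMap.ker (leval 0)).map (expPolyPair hβ)

theorem expPolyPair_snd (p : ℝ[X]) :
    (expPolyPair hβ p).snd = expPolyL2 hβ (derivative p - C (β / 2) * p) := rfl

theorem expPolyPair_eq_iff {p : ℝ[X]} {U : L2Pair} :
    expPolyPair hβ p = U ↔
      U.fst =ᵐ[muPos] expPoly β p ∧ U.snd =ᵐ[muPos] deriv (expPoly β p) := by
  have hfst : (expPolyPair hβ p).fst =ᵐ[muPos] expPoly β p := (memLp_expPoly hβ p).coeFn_toLp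
  have hsnd : (expPolyPair hβ p).snd =ᵐ[muPos] deriv (expPoly β p) := by
    rw [deriv_expPoly]
    exact (memLp_expPoly hβ _).coeFn_toLp
  constructor
  · rintro rfl
    exact ⟨hfst, hsnd⟩
  · rintro ⟨hU, hU'⟩
    exact WithLp.ofLp_injective 2
      (Prod.ext (Lp.ext (hfst.trans hU.symm)) (Lp.ext (hsnd.trans hU'.symm)))

theorem mem_galerkinSubmodule {N : ℕ} {U : L2Pair} :
    U ∈ galerkinSubmodule hβ N ↔ U ∈ galerkinSpace β N := by
  simp only [galerkinSubmodule, Submodule.mem_map, Submodule.mem_inf, LinearMap.mem_ker,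
    leval_apply, galerkinSpace, mem_ofPred_eq, expPolyPair_eq_iff, and_assoc, expPoly, mul_zero,
    zero_div, neg_zero, Real.exp_zero, one_mul]

theorem expPolyPair_mem_H10 {p : ℝ[X]} (hp : p.eval 0 = 0) : expPolyPair hβ p ∈ H10 := by
  obtain ⟨q, rfl⟩ : X ∣ p := by rwa [X_dvd_iff, coeff_zero_eq_eval_zero]
  have hL : MemLp (expPoly β (X * q)) 2 muPos := memLp_expPoly hβ _
  have hL' : MemLp (deriv (expPoly β (X * q))) 2 muPos := by
    rw [deriv_expPoly]
    exact memLp_expPoly hβ _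
  have hdiv : MemLp (fun x => expPoly β (X * q) x / x) 2 muPos := by
    refine (memLp_expPoly hβ q).ae_eq ?_
    filter_upwards [ae_restrict_mem measurableSet_Ioi] with x hx
    have hx0 : x ≠ 0 := ne_of_gt hx
    simp only [expPoly, eval_mul, eval_X]
    field_simp
  rw [(expPolyPair_eq_iff hβ (U := WithLp.toLp 2 (hL.toLp _, hL'.toLp _))).2
    ⟨hL.coeFn_toLp, hL'.coeFn_toLp⟩]
  exact mem_H10_of_contDiffOn (contDiff_expPoly β _).contDiffOn hL hL' hdiv

theorem galerkinSubmodule_subset_H10 (N : ℕ) : (galerkinSubmodule hβ N : Set L2Pair) ⊆ H10 := by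
  rintro _ ⟨p, hp, rfl⟩
  exact expPolyPair_mem_H10 hβ hp.2

end GalerkinSpace

/-- The operator `u ↦ u' + (β/2) u = e^{-βx/2} (e^{βx/2} u)'` on pairs `(u, u')`. On scaled Laguerre
functions it is differentiation of the polynomial factor. -/
noncomputable def weightedDeriv (β : ℝ) : L2Pair →L[ℝ] L2 :=
  WithLp.sndL 2 ℝ L2 L2 + (β / 2) • WithLp.fstL 2 ℝ L2 L2

section WeightedDeriv

variable {β : ℝ} {U : L2Pair}

theorem weightedDeriv_apply (β : ℝ) (U : L2Pair) :
    weightedDeriv β U = U.snd + (β / 2) • U.fst := rfl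

theorem weightedDeriv_expPolyPair (hβ : 0 < β) (p : ℝ[X]) :
    weightedDeriv β (expPolyPair hβ p) = expPolyL2 hβ (derivative p) := by
  have hfst : (expPolyPair hβ p).fst = expPolyL2 hβ p := rfl
  rw [weightedDeriv_apply, expPolyPair_snd, hfst, ← map_smul, ← map_add, smul_eq_C_mul,
    sub_add_cancel]

theorem norm_sq_weightedDeriv (hU : U ∈ H10) :
    ‖weightedDeriv β U‖ ^ 2 = ‖U.snd‖ ^ 2 + (β / 2 * ‖U.fst‖) ^ 2 := by
  rw [weightedDeriv_apply, norm_add_sq_real, inner_smul_right, real_inner_comm,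
    inner_fst_snd_eq_zero hU, norm_smul, Real.norm_eq_abs, mul_pow, mul_pow, sq_abs]
  ring

theorem norm_le_mul_norm_weightedDeriv (hβ : 0 < β) (hU : U ∈ H10) :
    ‖U‖ ≤ (1 + 2 / β) * ‖weightedDeriv β U‖ := by
  refine le_of_sq_le_sq ?_ (by positivity)
  calc ‖U‖ ^ 2 = (2 / β) ^ 2 * (β / 2 * ‖U.fst‖) ^ 2 + 1 * ‖U.snd‖ ^ 2 := by
        rw [WithLp.prod_norm_sq_eq_of_L2]
        field_simp
    _ ≤ (1 + 2 / β) ^ 2 * (β / 2 * ‖U.fst‖) ^ 2 + (1 + 2 / β) ^ 2 * ‖U.snd‖ ^ 2 := by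
        gcongr
        · linarith
        · exact one_le_pow₀ (le_add_of_nonneg_right (by positivity))
    _ = ((1 + 2 / β) * ‖weightedDeriv β U‖) ^ 2 := by
        rw [mul_pow _ ‖weightedDeriv β U‖, norm_sq_weightedDeriv hU]
        ring

theorem exists_weightedDeriv_eq (hβ : 0 < β) {N : ℕ} {g : L2} (hg : g ∈ lagSpace hβ N) :
    ∃ W ∈ galerkinSubmodule hβ (N + 1), weightedDeriv β W = g := by
  obtain ⟨q, hq, rfl⟩ := hg
  obtain ⟨p, hp, hp0, rfl⟩ := exists_mem_degreeLE_derivative_eq hq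
  exact ⟨expPolyPair hβ p, ⟨p, ⟨hp, hp0⟩, rfl⟩, weightedDeriv_expPolyPair hβ p⟩

theorem exists_mem_galerkinSubmodule_norm_sub_le (hβ : 0 < β) (N : ℕ) (hU : U ∈ H10) :
    ∃ W ∈ galerkinSubmodule hβ (N + 1), ‖U - W‖ ≤
      2 * ((1 / β + 1) * ‖U.snd - lagProj hβ N U.snd‖
        + (1 + β) * ‖U.fst - lagProj hβ N U.fst‖) := by
  obtain ⟨W, hW, hWU⟩ : ∃ W ∈ galerkinSubmodule hβ (N + 1),
      weightedDeriv β W = lagProj hβ N (weightedDeriv β U) :=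
    exists_weightedDeriv_eq hβ (Submodule.starProjection_apply_mem _ _)
  refine ⟨W, hW, ?_⟩
  set A := U.snd - lagProj hβ N U.snd
  set B := U.fst - lagProj hβ N U.fst
  have hres : weightedDeriv β (U - W) = A + (β / 2) • B := by
    rw [map_sub, hWU, weightedDeriv_apply, map_add, map_smul]
    module
  calc ‖U - W‖ ≤ (1 + 2 / β) * ‖A + (β / 2) • B‖ := by
        rw [← hres]
        exact norm_le_mul_norm_weightedDeriv hβ
          (sub_mem_H10 hU (galerkinSubmodule_subset_H10 hβ _ hW))
    _ ≤ (1 + 2 / β) * (‖A‖ + β / 2 * ‖B‖) := by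
        gcongr
        refine (norm_add_le _ _).trans_eq ?_
        rw [norm_smul, Real.norm_of_nonneg (by positivity)]
    _ = (2 * (1 / β) + 1) * ‖A‖ + (1 + β / 2) * ‖B‖ := by
        field_simp
        ring
    _ ≤ (2 * (1 / β) + 2) * ‖A‖ + (2 + 2 * β) * ‖B‖ := by
        gcongr <;> linarith
    _ = 2 * ((1 / β + 1) * ‖A‖ + (1 + β) * ‖B‖) := by ring

end WeightedDeriv

/-- The form `bilin γ` as a bundled bilinear form. -/
noncomputable def bilinForm (γ : ℝ) : LinearMap.BilinForm ℝ L2Pair :=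
  LinearMap.mk₂ ℝ (bilin γ)
    (fun U V W => by simp only [bilin, WithLp.add_fst, WithLp.add_snd, inner_add_left]; ring)
    (fun c U V => by
      simp only [bilin, WithLp.smul_fst, WithLp.smul_snd, real_inner_smul_left, smul_eq_mul]; ring)
    (fun U V W => by simp only [bilin, WithLp.add_fst, WithLp.add_snd, inner_add_right]; ring)
    (fun c U V => by
      simp only [bilin, WithLp.smul_fst, WithLp.smul_snd, real_inner_smul_right, smul_eq_mul]; ring)

theorem bilinForm_apply (γ : ℝ) (U V : L2Pair) : bilinForm γ U V = bilin γ U V := rfl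

theorem bilin_le {γ : ℝ} (hγ : 0 ≤ γ) (U V : L2Pair) :
    bilin γ U V ≤ (1 + γ) * ‖U‖ * ‖V‖ := by
  calc bilin γ U V ≤ ‖U.snd‖ * ‖V.snd‖ + γ * (‖U.fst‖ * ‖V.fst‖) := by
        unfold bilin
        gcongr <;> exact real_inner_le_norm _ _
    _ ≤ ‖U‖ * ‖V‖ + γ * (‖U‖ * ‖V‖) := by
        gcongr <;> first | exact WithLp.norm_fst_le _ _ | exact WithLp.norm_snd_le _ _
    _ = (1 + γ) * ‖U‖ * ‖V‖ := by ring

theorem min_mul_norm_sq_le_bilin_self (γ : ℝ) (U : L2Pair) :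
    min 1 γ * ‖U‖ ^ 2 ≤ bilin γ U U := by
  calc min 1 γ * ‖U‖ ^ 2 = min 1 γ * ‖U.snd‖ ^ 2 + min 1 γ * ‖U.fst‖ ^ 2 := by
        rw [WithLp.prod_norm_sq_eq_of_L2]
        ring
    _ ≤ 1 * ‖U.snd‖ ^ 2 + γ * ‖U.fst‖ ^ 2 := by
        gcongr
        exacts [min_le_left 1 γ, min_le_right 1 γ]
    _ = bilin γ U U := by
        rw [bilin, real_inner_self_eq_norm_sq, real_inner_self_eq_norm_sq, one_mul]

theorem integral_sub_integral_le {f g : ℝ → ℝ} (hf : MemLp f 2 muPos) (hg : MemLp g 2 muPos)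
    (v : L2) :
    (∫ x in Ioi (0 : ℝ), g x * v x) - ∫ x in Ioi (0 : ℝ), f x * v x ≤
      normL2 (fun x => f x - g x) * ‖v‖ := by
  have hnorm : ‖hg.toLp g - hf.toLp f‖ = normL2 (fun x => f x - g x) := by
    rw [norm_sub_rev, ← MemLp.toLp_sub, Lp.norm_toLp]
    rfl
  rw [← inner_eq_setIntegral hg.coeFn_toLp ae_eq_rfl, ← inner_eq_setIntegral hf.coeFn_toLp
    ae_eq_rfl, ← inner_sub_left, ← hnorm]
  exact real_inner_le_norm _ _

theorem bilinForm_sub_le {γ : ℝ} {f g : ℝ → ℝ} (hf : MemLp f 2 muPos) (hg : MemLp g 2 muPos)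
    {U W V : L2Pair} (hU : bilin γ U V = ∫ x in Ioi (0 : ℝ), f x * V.fst x)
    (hW : bilin γ W V = ∫ x in Ioi (0 : ℝ), g x * V.fst x) :
    bilinForm γ (W - U) V ≤ normL2 (fun x => f x - g x) * ‖V‖ := by
  rw [map_sub, LinearMap.sub_apply, bilinForm_apply, bilinForm_apply, hU, hW]
  exact (integral_sub_integral_le hf hg V.fst).trans
    (mul_le_mul_of_nonneg_left (WithLp.norm_fst_le _ V) ENNReal.toReal_nonneg)

end LaguerreGalerkin

theorem theorem5p8_general {γ : ℝ} (hγ : 0 < γ) {β : ℝ} (hβ : 0 < β) {N : ℕ} {f g : ℝ → ℝ}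
    (hf : MemLp f 2 muPos) (hg : MemLp g 2 muPos) {U UN : L2Pair} (hU : IsWeakSolution γ f U)
    (hUN : UN ∈ galerkinSpace β (N + 1))
    (hgal : ∀ V ∈ galerkinSpace β (N + 1),
      bilin γ UN V = ∫ x in Ioi (0 : ℝ), g x * V.fst x) :
    ‖U - UN‖ ≤ 2 * (1 + (1 + γ) / min 1 γ) * ((1 / β + 1) * ‖U.snd - lagProj hβ N U.snd‖
      + (1 + β) * ‖U.fst - lagProj hβ N U.fst‖ + normL2 (fun x => f x - g x)) := by
  simp only [← mem_galerkinSubmodule hβ] at hUN hgal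
  obtain ⟨W, hW, hUW⟩ := exists_mem_galerkinSubmodule_norm_sub_le hβ N hU.1
  have hc : 0 < min 1 γ := lt_min one_pos hγ
  have hD : 0 ≤ normL2 (fun x => f x - g x) := ENNReal.toReal_nonneg
  have hstrang := norm_sub_le_of_coercive hc hD (by positivity)
    (fun V _ => min_mul_norm_sq_le_bilin_self γ V) (fun V _ => bilin_le hγ.le (U - W) V)
    (fun V hV => bilinForm_sub_le hf hg (hU.2 V (galerkinSubmodule_subset_H10 hβ _ hV)) (hgal V hV))
    hUN hW
  set D := normL2 (fun x => f x - g x)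
  set R := (1 / β + 1) * ‖U.snd - lagProj hβ N U.snd‖ + (1 + β) * ‖U.fst - lagProj hβ N U.fst‖
  calc ‖U - UN‖ ≤ (1 + (1 + γ) / min 1 γ) * ‖U - W‖ + D / min 1 γ := hstrang
    _ ≤ (1 + (1 + γ) / min 1 γ) * (2 * R) + 2 * (1 + (1 + γ) / min 1 γ) * D := by
        gcongr
        rw [div_eq_inv_mul]
        gcongr
        rw [add_div, one_div]
        linarith [inv_pos.2 hc, div_pos hγ hc]
    _ = 2 * (1 + (1 + γ) / min 1 γ) * (R + D) := by ring

theorem theorem5p8 (γ : ℝ) (hγ : 0 < γ) :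
    ∃ C : ℝ, 0 < C ∧
      ∀ (Z : Rule) (β : ℝ) (hβ : 0 < β) (N : ℕ), 1 ≤ N →
      ∀ f : ℝ → ℝ, ContinuousOn f (Set.Ici 0) → MeasureTheory.MemLp f 2 muPos →
      ∀ U : L2Pair, IsWeakSolution γ f U →
      ∀ UN : L2Pair, IsGalerkinSolution Z γ β N f UN →
        ‖U - UN‖ ≤ C * ((1 / β + 1) * ‖U.snd - lagProj hβ (N - 1) U.snd‖
          + (1 + β) * ‖U.fst - lagProj hβ (N - 1) U.fst‖
          + normL2 (fun x => f x - interp Z β N f x)) := by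
  refine ⟨2 * (1 + (1 + γ) / min 1 γ), by positivity, fun Z β hβ N hN f _ hf U hU UN hUN => ?_⟩
  obtain ⟨N, rfl⟩ := Nat.exists_eq_add_of_le' hN
  exact theorem5p8_general hγ hβ hf (memLp_expPoly hβ _) hU hUN.1 hUN.2
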